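/- Let $N\ge 1$, let $X_1,\dots,X_N$ be independent real random variables (the observations, in this order), and let $\mu_1,\dots,\mu_N\in\mathbb R$. Observation $i$ is a success if $X_i>\mu_i$ and a failure otherwise. A success run is a maximal nonempty block of consecutive indices all of which are successes; its length is the number of its indices. A weight function $w$ assigns a real number, depending measurably on the observations, to the observations in each set of indices. On the event that there is at least one success, let $T$ be the largest weight of a success run, and write $P(T<T_{obs}\mid N)$ for the conditional probability of $T<T_{obs}$ given at least one success. (i) Suppose that $P(X_i>\mu_i)=\tfrac12$ for every $i$, let $T_{obs}\in\mathbb R$, and suppose that the conditional probability that a block of $l$ consecutive indices has weight less than $T_{obs}$, given that this block is a success run, depends only on its length $l$; denote it by $P(T<T_{obs}\mid l)$, $1\le l\le N$. Then $$P(T<T_{obs}\mid N)=\sum_{r=1}^{N}\ \sum_{M=1}^{\min(r,N-r+1)}\ \sum_{\pi}\ \prod_{l=1}^{N}\bigl[P(T<T_{obs}\mid l)\bigr]^{n_l}\cdot\frac{(N-r+2-M)_M}{(2^N-1)\prod_{l=1}^{N}n_l!},$$ where $\pi$ runs over the partitions of the integer $r$ into exactly $M$ positive parts, $n_l=n_l(\pi)$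 is the number of parts of $\pi$ equal to $l$, and $(x)_n=x(x+1)\cdots(x+n-1)$. (ii) Suppose that $X_i\sim\mathcal N(\mu_i,\sigma_i^2)$ with $\sigma_i>0$ for every $i$, let the weight of a set $A$ of observations be $\chi^2_{run}=\sum_{X_i\in A}(X_i-\mu_i)^2/\sigma_i^2$, and let $T_{obs}\ge 0$. Then for every block of $l\ge 1$ consecutive indices, the conditional probability that its weight is less than $T_{obs}$, given that the block is a success run, is $$P(T<T_{obs}\mid l)=\int_0^{T_{obs}}\frac{e^{-x/2}\,x^{-1+l/2}}{2^{l/2}\,\Gamma(l/2)}\,dx=\frac{\gamma(l/2,T_{obs}/2)}{\Gamma(l/2)},\qquad \gamma(a,x)=\int_0^x t^{a-1}e^{-t}\,dt,$$ the cumulative distribution function of the $\chi^2$ distribution with $l$ degrees of freedom, and the formula of (i) holds with these values of $P(T<T_{obs}\mid l)$. -/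

import Mathlib

open MeasureTheory ProbabilityTheory

namespace RunsStatistic

noncomputable section

/-- The set of successes of the data `x`: the indices `i` whose observation `x i` exceeds the
reference (expected) value `m i`. -/
def successSet {N : ℕ} (m x : Fin N → ℝ) : Finset (Fin N) :=
  Finset.univ.filter (fun i => m i < x i)

/-- `B` is a success run for the success set `S`: a nonempty block of consecutive indices, all of
them successes, which is preceded (followed) by a non-success or by the boundary. -/
def IsSuccessRun {N : ℕ} (S B : Finset (Fin N)) : Prop :=
  ∃ a b : Fin N, a ≤ b ∧ B = Finset.Icc a b ∧ B ⊆ S ∧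
    (∀ i : Fin N, (i : ℕ) + 1 = a → i ∉ S) ∧ (∀ i : Fin N, (b : ℕ) + 1 = i → i ∉ S)

open Classical in
/-- The success runs of the data `x` with reference values `m`. -/
def successRuns {N : ℕ} (m x : Fin N → ℝ) : Finset (Finset (Fin N)) :=
  Finset.univ.filter (fun B => IsSuccessRun (successSet m x) B)

/-- A weight function: to every set `B` of indices and every family of observations indexed by `B`
it assigns a real number. -/
abbrev Weight (N : ℕ) : Type := (B : Finset (Fin N)) → (B → ℝ) → ℝ

/-- The weight under `w` of the observations of `x` with index in `B`. -/
def runWeight {N : ℕ} (w : Weight N) (x : Fin N → ℝ) (B : Finset (Fin N)) : ℝ :=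
  w B (fun i => x i)

open Classical in
/-- The runs statistic `T`: the largest weight of a success run. (The value `0` for data without
any success is a placeholder.) -/
def runsStatistic {N : ℕ} (w : Weight N) (m x : Fin N → ℝ) : ℝ :=
  if h : (successRuns m x).Nonempty then (successRuns m x).sup' h (runWeight w x) else 0

/-- The `χ²` of a set of observations with means `m i` and standard deviations `σ i`. -/
def chiSqWeight {N : ℕ} (m σ : Fin N → ℝ) : Weight N :=
  fun B y => ∑ i : B, (y i - m i) ^ 2 / σ i ^ 2

/-- The conditional probability `P(T < t | N)`, given at least one success. -/
def probRunsStatisticLT {Ω : Type*} [MeasurableSpace Ω] (P : Measure Ω) {N : ℕ}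
    (X : Fin N → Ω → ℝ) (m : Fin N → ℝ) (w : Weight N) (t : ℝ) : ℝ :=
  (P[|{ω | ∃ i, m i < X i ω}]).real {ω | runsStatistic w m (fun i => X i ω) < t}

/-- The conditional probability that the run `B` has weight less than `t`, given that `B` is a
success run. -/
def probRunWeightLT {Ω : Type*} [MeasurableSpace Ω] (P : Measure Ω) {N : ℕ}
    (X : Fin N → Ω → ℝ) (m : Fin N → ℝ) (w : Weight N) (t : ℝ) (B : Finset (Fin N)) : ℝ :=
  (P[|{ω | B ∈ successRuns m (fun i => X i ω)}]).real
    {ω | runWeight w (fun i => X i ω) B < t}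

/-- The sum over the number `r` of successes, the number `M` of success runs and the partitions `π`
of `r` into exactly `M` parts, with `n_l = π.parts.count l`, of
`∏_l F(l) ^ n_l * (N - r + 2 - M)_M / ((2 ^ N - 1) * ∏_l n_l!)`.
Within the range of summation the natural number subtractions are exact, and
`x.ascFactorial M = x (x + 1) ⋯ (x + M - 1)` is the Pochhammer symbol. -/
def partitionSum (N : ℕ) (F : ℕ → ℝ) : ℝ :=
  ∑ r ∈ Finset.Icc 1 N, ∑ M ∈ Finset.Icc 1 (min r (N - r + 1)),
    ∑ π ∈ (Finset.univ : Finset r.Partition).filter (fun π => π.parts.card = M),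
      (∏ l ∈ Finset.Icc 1 N, F l ^ π.parts.count l) *
        (((N - r + 2 - M).ascFactorial M : ℕ) : ℝ) /
          (((2 : ℝ) ^ N - 1) * ∏ l ∈ Finset.Icc 1 N, ((π.parts.count l).factorial : ℝ))

/-- The lower incomplete gamma function `γ(a, x) = ∫₀ˣ t ^ (a - 1) e ^ (-t) dt`, for `a > 0` and
`x ≥ 0`. -/
def lowerGamma (a x : ℝ) : ℝ := ∫ t in (0 : ℝ)..x, t ^ (a - 1) * Real.exp (-t)

end

end RunsStatistic

/-!
The success pattern `S` of the observations is uniformly distributed on the subsets of the index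
set, and given the pattern, the observations in the different runs are independent. Given that
`S` is the set of successes, the event `T < t` says that every run of `S` has weight less than `t`,
so it has probability `∏ F |B|` over the runs `B` of `S`
(`measureReal_successSet_inter_weights`). Here the condition that `B` is a success run may be
replaced by the condition that `B` consists of successes, since the neighbours of `B` are
independent of `B` (`probRunWeightLT_mul_allSuccess`).

It remains to sum `∏ F |B|` over all nonempty patterns. A pattern with `r` successes is a sequence
of `N - r + 1` possibly empty runs separated by the `N - r` failures. With
`G = 1 + ∑ F l x ^ l`, the sum over these patterns is therefore the coefficient of `x ^ r` in
`G ^ (N - r + 1)` (`runSum_eq_sum_coeff`). The recursion behind this comes from removing the part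
of the pattern after the last failure (`runSum_eq`). Expanding the power, first by the binomial
theorem, where `M` is the number of nonempty runs, and then by the multinomial theorem, gives the
sum over partitions (`coeff_mk_emptyOne_pow`).

For Gaussian observations, the moment generating function of the weight of a block of `l` successes
factorizes over the block, and each factor is a Gaussian integral over a half line. The result is
the moment generating function of the gamma distribution with shape `l / 2` and rate `1 / 2`, which
determines the law (`map_chiSqWeight_cond`).
-/

namespace RunsStatistic

/-! ### Runs of finite sets of natural numbers -/

open Classical in
/-- The runs of a finite set of natural numbers: the pairs `(a, b)` such that `{a, …, b}` is a
maximal nonempty block of consecutive elements of `S`. -/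
noncomputable def natRuns (S : Finset ℕ) : Finset (ℕ × ℕ) :=
  (S ×ˢ S).filter fun p => p.1 ≤ p.2 ∧ Finset.Icc p.1 p.2 ⊆ S ∧ (∀ i, i + 1 = p.1 → i ∉ S) ∧
    p.2 + 1 ∉ S

/-- The product of `F (length)` over the runs of `S`. -/
noncomputable def runProd (F : ℕ → ℝ) (S : Finset ℕ) : ℝ :=
  ∏ p ∈ natRuns S, F (p.2 + 1 - p.1)

/-- `F` with its value at `0` replaced by `1`: the contribution of a possibly empty run. -/
noncomputable def emptyOne (F : ℕ → ℝ) (l : ℕ) : ℝ := if l = 0 then 1 else F l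

lemma mem_natRuns {S : Finset ℕ} {a b : ℕ} : (a, b) ∈ natRuns S ↔
    a ≤ b ∧ Finset.Icc a b ⊆ S ∧ (∀ i, i + 1 = a → i ∉ S) ∧ b + 1 ∉ S := by
  simp only [natRuns, Finset.mem_filter, Finset.mem_product]
  constructor
  · exact fun h => h.2
  · intro h
    exact ⟨⟨h.2.1 (Finset.left_mem_Icc.2 h.1), h.2.1 (Finset.right_mem_Icc.2 h.1)⟩, h⟩

lemma natRuns_range_succ (n : ℕ) : natRuns (Finset.range (n + 1)) = {(0, n)} := by
  ext ⟨a, b⟩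
  simp only [mem_natRuns, Finset.mem_singleton, Prod.mk.injEq, Finset.mem_range]
  constructor
  · rintro ⟨hab, hsub, ha, hb⟩
    have h1 := Finset.mem_range.1 (hsub (Finset.right_mem_Icc.2 hab))
    refine ⟨?_, by omega⟩
    by_contra h0
    exact ha (a - 1) (by omega) (by omega)
  · rintro ⟨rfl, rfl⟩
    refine ⟨by omega, fun i hi => ?_, by omega, by omega⟩
    have := Finset.mem_Icc.1 hi
    exact Finset.mem_range.2 (by omega)

lemma runProd_empty (F : ℕ → ℝ) : runProd F ∅ = 1 := by simp [runProd, natRuns]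

lemma runProd_range (F : ℕ → ℝ) (n : ℕ) : runProd F (Finset.range n) = emptyOne F n := by
  cases n with
  | zero => simp [runProd_empty, emptyOne]
  | succ n => simp [runProd, natRuns_range_succ, emptyOne]

lemma natRuns_union_Ico {n : ℕ} (j : ℕ) {S : Finset ℕ} (hS : S ⊆ Finset.range n) :
    natRuns (S ∪ Finset.Ico (n + 1) (n + 1 + (j + 1))) =
      insert (n + 1, n + 1 + j) (natRuns S) := by
  have hS' : ∀ i ∈ S, i < n := fun i hi => Finset.mem_range.1 (hS hi)
  ext ⟨a, b⟩
  simp only [mem_natRuns, Finset.mem_insert, Prod.mk.injEq, Finset.mem_union, Finset.mem_Ico,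
    Finset.subset_iff, Finset.mem_Icc]
  constructor
  · rintro ⟨hab, hsub, ha, hb⟩
    have h1 := hsub (x := a) (by omega)
    have h2 := hsub (x := b) (by omega)
    rcases h2 with h2 | h2
    · right
      have hbn := hS' _ h2
      refine ⟨hab, fun x hx => ?_, fun i hi hiS => ha i hi (Or.inl hiS), fun h => hb (Or.inl h)⟩
      exact (hsub hx).resolve_right (by omega)
    · left
      -- the index `n` separates `S` from the new block
      have ha1 : n < a := by
        by_contra hlt
        rcases hsub (x := n) (by omega) with h | h
        · exact absurd (hS' _ h) (by omega)
        · omega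
      have hb' : ¬ (b + 1 < n + 1 + (j + 1)) := fun h => hb (Or.inr ⟨by omega, h⟩)
      refine ⟨?_, by omega⟩
      by_contra hne
      exact ha (a - 1) (by omega) (Or.inr (by omega))
  · rintro (⟨rfl, rfl⟩ | ⟨hab, hsub, ha, hb⟩)
    · refine ⟨by omega, fun x hx => Or.inr (by omega), ?_, ?_⟩
      · rintro i hi (h | h)
        · exact absurd (hS' _ h) (by omega)
        · omega
      · rintro (h | h)
        · exact absurd (hS' _ h) (by omega)
        · omega
    · have hbn := hS' b (hsub ⟨hab, le_rfl⟩)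
      refine ⟨hab, fun x hx => Or.inl (hsub hx), ?_, ?_⟩
      · rintro i hi (h | h)
        · exact ha i hi h
        · omega
      · rintro (h | h)
        · exact hb h
        · omega

lemma runProd_union_Ico (F : ℕ → ℝ) {n : ℕ} (j : ℕ) {S : Finset ℕ}
    (hS : S ⊆ Finset.range n) :
    runProd F (S ∪ Finset.Ico (n + 1) (n + 1 + j)) = runProd F S * emptyOne F j := by
  cases j with
  | zero => simp [emptyOne]
  | succ j =>
    have hnot : (n + 1, n + 1 + j) ∉ natRuns S := by
      rw [mem_natRuns]
      rintro ⟨_, h, -⟩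
      have := Finset.mem_range.1 (hS (h (Finset.left_mem_Icc.2 (by omega))))
      omega
    rw [runProd, natRuns_union_Ico j hS, Finset.prod_insert hnot, mul_comm, runProd]
    congr 1
    rw [emptyOne, if_neg (by omega)]
    congr 1
    dsimp only
    omega

/-- The sum, over the subsets `S` of `{0, …, n - 1}`, of the product of `F (length)` over the
runs of `S`. -/
noncomputable def runSum (F : ℕ → ℝ) (n : ℕ) : ℝ :=
  ∑ S ∈ (Finset.range n).powerset, runProd F S

/-- Deciding for the indices `n - 1, n - 2, …` in turn whether they belong to `S`, while keeping
track of the length `j` of the block already known to follow. -/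
lemma sum_runProd_union_Ico (F : ℕ → ℝ) (n j : ℕ) :
    ∑ S ∈ (Finset.range n).powerset, runProd F (S ∪ Finset.Ico n (n + j)) =
      emptyOne F (n + j) + ∑ c ∈ Finset.range n, runSum F c * emptyOne F (n - 1 - c + j) := by
  induction n generalizing j with
  | zero => simp [runProd_range]
  | succ n ih =>
    rw [Finset.range_add_one, Finset.sum_powerset_insert Finset.notMem_range_self,
      Finset.sum_insert Finset.notMem_range_self]
    have h1 : ∑ S ∈ (Finset.range n).powerset,
        runProd F (S ∪ Finset.Ico (n + 1) (n + 1 + j)) = runSum F n * emptyOne F j := by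
      rw [runSum, Finset.sum_mul]
      exact Finset.sum_congr rfl fun S hS => runProd_union_Ico F j (Finset.mem_powerset.1 hS)
    have h2 : ∑ S ∈ (Finset.range n).powerset,
        runProd F (insert n S ∪ Finset.Ico (n + 1) (n + 1 + j)) =
        ∑ S ∈ (Finset.range n).powerset, runProd F (S ∪ Finset.Ico n (n + (j + 1))) := by
      refine Finset.sum_congr rfl fun S _ => congrArg _ ?_
      ext i
      simp only [Finset.mem_union, Finset.mem_insert, Finset.mem_Ico]
      have : (i = n ∨ n + 1 ≤ i ∧ i < n + 1 + j) ↔ (n ≤ i ∧ i < n + (j + 1)) := by omega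
      rw [← this]
      tauto
    rw [h1, h2, ih (j + 1)]
    have h3 : ∑ c ∈ Finset.range n, runSum F c * emptyOne F (n - 1 - c + (j + 1)) =
        ∑ c ∈ Finset.range n, runSum F c * emptyOne F (n + 1 - 1 - c + j) := by
      refine Finset.sum_congr rfl fun c hc => ?_
      have := Finset.mem_range.1 hc
      congr 2
      omega
    rw [h3, show n + (j + 1) = n + 1 + j by omega, show n + 1 - 1 - n + j = j by omega]
    ring

/-- Splitting the subsets of `{0, …, n - 1}` by their last missing element `c`. -/
lemma runSum_eq (F : ℕ → ℝ) (n : ℕ) : runSum F n =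
    emptyOne F n + ∑ c ∈ Finset.range n, runSum F c * emptyOne F (n - 1 - c) := by
  simpa [runSum] using sum_runProd_union_Ico F n 0

/-! ### The generating function of the run sums -/

open PowerSeries in
/-- The recursion of `runSum_eq` as the equation `f = G + X G f` of generating functions. -/
lemma mk_runSum (F : ℕ → ℝ) : (PowerSeries.mk (runSum F)) =
    PowerSeries.mk (emptyOne F) +
      X * (PowerSeries.mk (emptyOne F) * PowerSeries.mk (runSum F)) := by
  ext n
  cases n with
  | zero => simp [runSum_eq F 0]
  | succ n =>
    rw [map_add, coeff_succ_X_mul, coeff_mk, coeff_mk, runSum_eq, mul_comm, coeff_mul,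
      Finset.Nat.sum_antidiagonal_eq_sum_range_succ_mk]
    simp

open PowerSeries in
/-- The geometric series for `f = G / (1 - X G)`, with its remainder. -/
lemma mk_runSum_iterate (F : ℕ → ℝ) (K : ℕ) : (PowerSeries.mk (runSum F)) =
    ∑ k ∈ Finset.range K, X ^ k * PowerSeries.mk (emptyOne F) ^ (k + 1) +
      X ^ K * (PowerSeries.mk (emptyOne F) ^ K * PowerSeries.mk (runSum F)) := by
  induction K with
  | zero => simp
  | succ K ih =>
    have h := congrArg (fun p => X ^ K * (PowerSeries.mk (emptyOne F) ^ K * p)) (mk_runSum F)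
    refine (ih.trans (congrArg _ h)).trans ?_
    rw [Finset.sum_range_succ]
    ring

open PowerSeries in
/-- A subset of `{0, …, N - 1}` with `r` elements amounts to a sequence of `N - r + 1` possibly
empty runs with total length `r`. -/
lemma runSum_eq_sum_coeff (F : ℕ → ℝ) (N : ℕ) : runSum F N =
    ∑ r ∈ Finset.range (N + 1), coeff r (PowerSeries.mk (emptyOne F) ^ (N - r + 1)) := by
  -- the remainder is divisible by `X ^ (N + 1)`
  have h := congrArg (coeff N) (mk_runSum_iterate F (N + 1))
  rw [coeff_mk, map_add, coeff_X_pow_mul', if_neg (by omega), add_zero, map_sum] at h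
  rw [h, ← Finset.sum_range_reflect]
  refine Finset.sum_congr rfl fun k hk => ?_
  have := Finset.mem_range.1 hk
  rw [coeff_X_pow_mul', if_pos (by omega)]
  have h1 : N + 1 - 1 - k = N - k := by omega
  have h2 : N - (N - k) = k := by omega
  rw [h1, h2]

open PowerSeries in
/-- The coefficients of the powers of `∑_{1 ≤ l ≤ N} F l X ^ l`, by the multinomial theorem. -/
lemma coeff_sum_pow_eq_sum_partition (F : ℕ → ℝ) {N r : ℕ} (hr : r ≤ N) (M : ℕ) :
    coeff r ((∑ l ∈ Finset.Icc 1 N, PowerSeries.C (F l) * X ^ l : PowerSeries ℝ) ^ M) =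
      ∑ π ∈ (Finset.univ : Finset r.Partition).filter (fun π => π.parts.card = M),
        (Nat.multinomial (Finset.Icc 1 N) (fun l => π.parts.count l) : ℝ) *
          ∏ l ∈ Finset.Icc 1 N, F l ^ π.parts.count l := by
  classical
  have hterm : ∀ κ : ℕ → ℕ, coeff r ((Nat.multinomial (Finset.Icc 1 N) κ : PowerSeries ℝ) *
      ∏ l ∈ Finset.Icc 1 N, (PowerSeries.C (F l) * X ^ l) ^ κ l) =
      if r = ∑ l ∈ Finset.Icc 1 N, l * κ l then
        (Nat.multinomial (Finset.Icc 1 N) κ : ℝ) * ∏ l ∈ Finset.Icc 1 N, F l ^ κ l else 0 := by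
    intro κ
    simp_rw [mul_pow, Finset.prod_mul_distrib, ← map_pow, ← map_prod, ← pow_mul,
      Finset.prod_pow_eq_pow_sum]
    rw [← map_natCast (PowerSeries.C (R := ℝ)), ← mul_assoc, ← map_mul, coeff_C_mul_X_pow]
  rw [Finset.sum_pow_eq_sum_piAntidiag, map_sum, Finset.sum_congr rfl fun κ _ => hterm κ,
    ← Finset.sum_filter]
  have hsub : ∀ π : r.Partition, π.parts.toFinset ⊆ Finset.Icc 1 N := fun π l hl => by
    have h := Multiset.mem_toFinset.1 hl
    exact Finset.mem_Icc.2 ⟨π.parts_pos h, (π.parts_sum ▸ Multiset.le_sum_of_mem h).trans hr⟩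
  symm
  -- a partition corresponds to its multiplicity function
  refine Finset.sum_bij (fun π _ l => π.parts.count l) ?_ ?_ ?_ ?_
  · intro π hπ
    rw [Finset.mem_filter, Finset.mem_piAntidiag]
    refine ⟨⟨?_, fun l hl => ?_⟩, ?_⟩
    · rw [← (Finset.mem_filter.1 hπ).2]
      exact Multiset.sum_count_eq_card fun l hl => hsub π (Multiset.mem_toFinset.2 hl)
    · exact hsub π (Multiset.mem_toFinset.2 (Multiset.count_ne_zero.1 hl))
    · conv_lhs => rw [← π.parts_sum]
      rw [Finset.sum_multiset_count_of_subset _ _ (hsub π)]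
      exact Finset.sum_congr rfl fun l _ => by rw [smul_eq_mul, mul_comm]
  · intro π _ π' _ h
    exact Nat.Partition.ext (Multiset.ext.2 fun l => congrFun h l)
  · intro κ hκ
    rw [Finset.mem_filter, Finset.mem_piAntidiag] at hκ
    obtain ⟨⟨hcard, hsupp⟩, hsum⟩ := hκ
    have hcount : ∀ l, (∑ i ∈ Finset.Icc 1 N, Multiset.replicate (κ i) i).count l = κ l := by
      intro l
      rw [Multiset.count_sum']
      simp only [Multiset.count_replicate]
      by_cases hl : l ∈ Finset.Icc 1 N
      · rw [Finset.sum_ite_eq', if_pos hl]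
      · rw [Finset.sum_ite_eq', if_neg hl]
        by_contra h
        exact hl (hsupp l (Ne.symm h))
    refine ⟨⟨∑ i ∈ Finset.Icc 1 N, Multiset.replicate (κ i) i, ?_, ?_⟩, ?_, ?_⟩
    · intro i hi
      obtain ⟨j, hj, hij⟩ := Multiset.mem_sum.1 hi
      rw [Multiset.eq_of_mem_replicate hij]
      exact (Finset.mem_Icc.1 hj).1
    · rw [hsum, ← Multiset.coe_sumAddMonoidHom, map_sum]
      exact Finset.sum_congr rfl fun i _ => by simp [mul_comm]
    · simp [Multiset.card_sum, hcard]
    · exact funext hcount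
  · intro π _
    rfl

lemma filter_card_parts_eq_empty {r M : ℕ} (h : M ∉ Finset.Icc 1 r) (hr : r ≠ 0) :
    (Finset.univ : Finset r.Partition).filter (fun π => π.parts.card = M) = ∅ := by
  refine Finset.filter_eq_empty_iff.2 fun π _ hπ => h (Finset.mem_Icc.2 ⟨?_, ?_⟩)
  · rw [Nat.one_le_iff_ne_zero, ← hπ]
    intro h0
    have := π.parts_sum
    rw [Multiset.card_eq_zero.1 h0] at this
    exact hr this.symm
  · have := Multiset.card_nsmul_le_sum (a := 1) (fun x hx => π.parts_pos hx)
    rwa [π.parts_sum, smul_eq_mul, mul_one, hπ] at this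

open PowerSeries in
/-- In `(1 + ∑ F l X ^ l) ^ k` the exponent `M` of the binomial expansion counts the nonempty runs
among `k` possibly empty ones. The partition lists the lengths of the nonempty runs. -/
lemma coeff_mk_emptyOne_pow (F : ℕ → ℝ) {N r : ℕ} (hr0 : r ≠ 0) (hr : r ≤ N) (k : ℕ) :
    coeff r (PowerSeries.mk (emptyOne F) ^ k) =
      ∑ M ∈ Finset.Icc 1 (min r k),
        ∑ π ∈ (Finset.univ : Finset r.Partition).filter (fun π => π.parts.card = M),
          (∏ l ∈ Finset.Icc 1 N, F l ^ π.parts.count l) *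
            (((k + 1 - M).ascFactorial M : ℕ) : ℝ) /
              ∏ l ∈ Finset.Icc 1 N, ((π.parts.count l).factorial : ℝ) := by
  -- coefficients up to `X ^ N` only depend on the values of `F` up to `N`
  have htrunc : ((trunc (N + 1) (PowerSeries.mk (emptyOne F)) : Polynomial ℝ) : PowerSeries ℝ) =
      ∑ l ∈ Finset.Icc 1 N, PowerSeries.C (F l) * X ^ l + 1 := by
    ext n
    rw [Polynomial.coeff_coe, coeff_trunc, coeff_mk, map_add, map_sum, coeff_one]
    simp_rw [coeff_C_mul_X_pow, emptyOne]
    rw [Finset.sum_ite_eq]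
    rcases Nat.eq_zero_or_pos n with rfl | hn
    · simp
    · simp [hn.ne', Nat.succ_le_iff, hn]
  have hcoeff : coeff r (PowerSeries.mk (emptyOne F) ^ k) =
      coeff r ((∑ l ∈ Finset.Icc 1 N, PowerSeries.C (F l) * X ^ l + 1) ^ k) := by
    have h := congrArg (Polynomial.coeff · r)
      (trunc_trunc_pow (PowerSeries.mk (emptyOne F)) (N + 1) k)
    rw [htrunc] at h
    simpa [coeff_trunc, hr] using h.symm
  rw [hcoeff, add_pow, map_sum]
  have hzero : ∀ M, M ∉ Finset.Icc 1 r →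
      coeff r ((∑ l ∈ Finset.Icc 1 N, PowerSeries.C (F l) * X ^ l : PowerSeries ℝ) ^ M) = 0 := by
    intro M hM
    rw [coeff_sum_pow_eq_sum_partition F hr, filter_card_parts_eq_empty hM hr0,
      Finset.sum_empty]
  have hmul : ∀ M, coeff r ((∑ l ∈ Finset.Icc 1 N, PowerSeries.C (F l) * X ^ l) ^ M *
      1 ^ (k - M) * (k.choose M : PowerSeries ℝ)) =
      coeff r ((∑ l ∈ Finset.Icc 1 N, PowerSeries.C (F l) * X ^ l : PowerSeries ℝ) ^ M) *
        k.choose M := by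
    intro M
    rw [one_pow, mul_one, ← map_natCast (PowerSeries.C (R := ℝ)), coeff_mul_C]
  rw [Finset.sum_congr rfl fun M _ => hmul M]
  symm
  refine Finset.sum_subset_zero_on_sdiff (fun M hM => ?_) (fun M hM => ?_) (fun M hM => ?_)
  · have := Finset.mem_Icc.1 hM
    exact Finset.mem_range.2 (by omega)
  · rw [hzero, zero_mul]
    simp only [Finset.mem_sdiff, Finset.mem_range, Finset.mem_Icc] at hM ⊢
    omega
  · rw [coeff_sum_pow_eq_sum_partition F hr, Finset.sum_mul]
    refine Finset.sum_congr rfl fun π hπ => ?_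
    have hM' := Finset.mem_Icc.1 hM
    have hcard : ∑ l ∈ Finset.Icc 1 N, π.parts.count l = M := by
      rw [← (Finset.mem_filter.1 hπ).2]
      refine Multiset.sum_count_eq_card fun l hl => Finset.mem_Icc.2 ⟨π.parts_pos hl, ?_⟩
      exact (π.parts_sum ▸ Multiset.le_sum_of_mem hl).trans hr
    have hspec := Nat.multinomial_spec (Finset.Icc 1 N) (fun l => π.parts.count l)
    rw [hcard] at hspec
    -- `(k + 1 - M)_M` arises from `choose k M * multinomial` after cancelling `M!`
    have hasc : (k + 1 - M).ascFactorial M = M.factorial * k.choose M := by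
      rw [show k + 1 - M = k - M + 1 by omega, Nat.ascFactorial_eq_factorial_mul_choose,
        Nat.sub_add_cancel (by omega)]
    have hpos : (∏ l ∈ Finset.Icc 1 N, ((π.parts.count l).factorial : ℝ)) ≠ 0 :=
      Finset.prod_ne_zero_iff.2 fun l _ => by positivity
    rw [hasc, ← hspec, div_eq_iff hpos]
    push_cast
    ring

/-- The partition formula evaluates the sum of the run products over all nonempty subsets. -/
lemma partitionSum_eq_runSum (F : ℕ → ℝ) (N : ℕ) :
    partitionSum N F = (runSum F N - 1) / (2 ^ N - 1) := by
  rw [runSum_eq_sum_coeff, Finset.sum_range_eq_add_Ico _ (by omega)]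
  -- the term `r = 0` comes from the empty set
  have h0 : PowerSeries.coeff 0 (PowerSeries.mk (emptyOne F) ^ (N - 0 + 1)) = 1 := by
    simp [emptyOne]
  rw [h0, add_sub_cancel_left, partitionSum, Finset.sum_div]
  have hIco : Finset.Ico 1 (N + 1) = Finset.Icc 1 N := by ext; simp
  rw [hIco]
  refine Finset.sum_congr rfl fun r hr => ?_
  have hr' := Finset.mem_Icc.1 hr
  rw [coeff_mk_emptyOne_pow F (by omega) hr'.2, Finset.sum_div]
  refine Finset.sum_congr rfl fun M _ => ?_
  rw [Finset.sum_div]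
  refine Finset.sum_congr rfl fun π _ => ?_
  rw [div_div, mul_comm (_ - _ : ℝ)]

/-! ### The success runs of a set of indices -/

lemma isSuccessRun_Icc_iff {N : ℕ} {S : Finset (Fin N)} {a b : Fin N} (hab : a ≤ b) :
    IsSuccessRun S (Finset.Icc a b) ↔ Finset.Icc a b ⊆ S ∧
      (∀ i : Fin N, (i : ℕ) + 1 = a → i ∉ S) ∧ (∀ i : Fin N, (b : ℕ) + 1 = i → i ∉ S) := by
  constructor
  · rintro ⟨a', b', hab', hB, h1, h2, h3⟩
    have ha := Finset.mem_Icc.1 (hB ▸ Finset.left_mem_Icc.2 hab)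
    have hb := Finset.mem_Icc.1 (hB ▸ Finset.right_mem_Icc.2 hab)
    have ha' := Finset.mem_Icc.1 (hB.symm ▸ Finset.left_mem_Icc.2 hab')
    have hb' := Finset.mem_Icc.1 (hB.symm ▸ Finset.right_mem_Icc.2 hab')
    obtain rfl : a = a' := le_antisymm ha'.1 ha.1
    obtain rfl : b = b' := le_antisymm hb.2 hb'.2
    exact ⟨h1, h2, h3⟩
  · exact fun h => ⟨a, b, hab, rfl, h⟩

lemma IsSuccessRun.subset {N : ℕ} {S B : Finset (Fin N)} (h : IsSuccessRun S B) : B ⊆ S := by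
  obtain ⟨_, _, _, _, h, _⟩ := h
  exact h

lemma IsSuccessRun.eq_of_mem {N : ℕ} {S B B' : Finset (Fin N)} (h : IsSuccessRun S B)
    (h' : IsSuccessRun S B') {i : Fin N} (hi : i ∈ B) (hi' : i ∈ B') : B = B' := by
  obtain ⟨a, b, hab, rfl, hS, ha, hb⟩ := h
  obtain ⟨a', b', hab', rfl, hS', ha', hb'⟩ := h'
  rw [Finset.mem_Icc] at hi hi'
  -- otherwise the index before `a'` would be a success inside `Icc a b`
  have key : ∀ {a b a' b' : Fin N}, Finset.Icc a b ⊆ S →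
      (∀ i : Fin N, (i : ℕ) + 1 = a' → i ∉ S) → a ≤ i → i ≤ b → a' ≤ i → a' ≤ a := by
    intro a b a' b' hS ha' h1 h2 h3
    by_contra hlt
    rw [Fin.le_def] at *
    refine ha' ⟨(a' : ℕ) - 1, by omega⟩ (by simp only; omega) (hS (Finset.mem_Icc.2 ⟨?_, ?_⟩)) <;>
    · rw [Fin.le_def]; simp only; omega
  have key' : ∀ {a b b' : Fin N}, Finset.Icc a b ⊆ S →
      (∀ i : Fin N, (b' : ℕ) + 1 = i → i ∉ S) → a ≤ i → i ≤ b → i ≤ b' → b ≤ b' := by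
    intro a b b' hS hb' h1 h2 h3
    by_contra hlt
    rw [Fin.le_def] at *
    refine hb' ⟨(b' : ℕ) + 1, by omega⟩ (by simp only) (hS (Finset.mem_Icc.2 ⟨?_, ?_⟩)) <;>
    · rw [Fin.le_def]; simp only; omega
  rw [le_antisymm (key (b := b') (b' := b') hS' ha hi'.1 hi'.2 hi.1)
      (key (b := b) (b' := b) hS ha' hi.1 hi.2 hi'.1),
    le_antisymm (key' hS hb' hi.1 hi.2 hi'.2) (key' hS' hb hi'.1 hi'.2 hi.2)]

lemma exists_isSuccessRun_mem {N : ℕ} {S : Finset (Fin N)} {i : Fin N} (hi : i ∈ S) :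
    ∃ B, IsSuccessRun S B ∧ i ∈ B := by
  -- extend the block as far as possible to the left and to the right of `i`
  have hleft : ∀ n : ℕ, ∀ i : Fin N, (i : ℕ) = n → i ∈ S →
      ∃ a ≤ i, Finset.Icc a i ⊆ S ∧ ∀ j : Fin N, (j : ℕ) + 1 = a → j ∉ S := by
    intro n
    induction n with
    | zero =>
      intro i hin hi
      exact ⟨i, le_rfl, by simpa using hi, fun j hj => by omega⟩
    | succ n ih =>
      intro i hin hi
      by_cases hj : (⟨n, by omega⟩ : Fin N) ∈ S
      · obtain ⟨a, ha, hS, h⟩ := ih ⟨n, by omega⟩ rfl hj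
        rw [Fin.le_def] at ha
        refine ⟨a, by rw [Fin.le_def]; simp only at ha; omega, fun x hx => ?_, h⟩
        rw [Finset.mem_Icc, Fin.le_def, Fin.le_def] at hx
        rcases eq_or_ne x i with rfl | hne
        · exact hi
        · have := Fin.val_ne_of_ne hne
          exact hS (Finset.mem_Icc.2 ⟨hx.1, by rw [Fin.le_def]; simp only; omega⟩)
      · refine ⟨i, le_rfl, by simpa using hi, fun j hj' hjS => hj ?_⟩
        rwa [show (⟨n, by omega⟩ : Fin N) = j from Fin.ext (by simp only; omega)]
  have hright : ∀ n : ℕ, ∀ i : Fin N, (i : ℕ) + n + 1 = N → i ∈ S →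
      ∃ b ≥ i, Finset.Icc i b ⊆ S ∧ ∀ j : Fin N, (b : ℕ) + 1 = j → j ∉ S := by
    intro n
    induction n with
    | zero =>
      intro i hin hi
      exact ⟨i, le_rfl, by simpa using hi, fun j hj => by omega⟩
    | succ n ih =>
      intro i hin hi
      by_cases hj : (⟨i + 1, by omega⟩ : Fin N) ∈ S
      · obtain ⟨b, hb, hS, h⟩ := ih ⟨i + 1, by omega⟩ (by simp only; omega) hj
        rw [ge_iff_le, Fin.le_def] at hb
        refine ⟨b, by rw [ge_iff_le, Fin.le_def]; simp only at hb; omega, fun x hx => ?_, h⟩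
        rw [Finset.mem_Icc, Fin.le_def, Fin.le_def] at hx
        rcases eq_or_ne x i with rfl | hne
        · exact hi
        · have := Fin.val_ne_of_ne hne
          exact hS (Finset.mem_Icc.2 ⟨by rw [Fin.le_def]; simp only; omega, hx.2⟩)
      · refine ⟨i, le_rfl, by simpa using hi, fun j hj' hjS => hj ?_⟩
        rwa [show (⟨i + 1, by omega⟩ : Fin N) = j from Fin.ext (by simp only; omega)]
  obtain ⟨a, ha, haS, ha'⟩ := hleft i i rfl hi
  obtain ⟨b, hb, hbS, hb'⟩ := hright (N - i - 1) i (by omega) hi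
  refine ⟨Finset.Icc a b, ⟨a, b, ha.trans hb, rfl, fun x hx => ?_, ha', hb'⟩,
    Finset.mem_Icc.2 ⟨ha, hb⟩⟩
  rw [Finset.mem_Icc] at hx
  rcases le_total x i with h | h
  · exact haS (Finset.mem_Icc.2 ⟨hx.1, h⟩)
  · exact hbS (Finset.mem_Icc.2 ⟨h, hx.2⟩)

open Classical in
/-- The success runs when `S` is the set of successes. -/
noncomputable def runsOf {N : ℕ} (S : Finset (Fin N)) : Finset (Finset (Fin N)) :=
  Finset.univ.filter (IsSuccessRun S)

lemma mem_runsOf {N : ℕ} {S B : Finset (Fin N)} : B ∈ runsOf S ↔ IsSuccessRun S B := by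
  simp [runsOf]

lemma successRuns_eq_runsOf {N : ℕ} (m x : Fin N → ℝ) :
    successRuns m x = runsOf (successSet m x) := rfl

lemma prod_runsOf_eq_runProd {N : ℕ} (F : ℕ → ℝ) (S : Finset (Fin N)) :
    ∏ B ∈ runsOf S, F B.card = runProd F (S.map Fin.valEmbedding) := by
  have hmem : ∀ (n : ℕ) (h : n < N), n ∈ S.map Fin.valEmbedding ↔ (⟨n, h⟩ : Fin N) ∈ S := by
    intro n h
    rw [← Finset.mem_map' Fin.valEmbedding (a := (⟨n, h⟩ : Fin N))]
    rfl
  have hlt : ∀ n ∈ S.map Fin.valEmbedding, n < N := by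
    intro n hn
    obtain ⟨i, _, rfl⟩ := Finset.mem_map.1 hn
    exact i.2
  have hpair : ∀ p ∈ natRuns (S.map Fin.valEmbedding), p.1 < N ∧ p.2 < N := by
    rintro ⟨a, b⟩ hp
    rw [mem_natRuns] at hp
    exact ⟨hlt _ (hp.2.1 (Finset.left_mem_Icc.2 hp.1)),
      hlt _ (hp.2.1 (Finset.right_mem_Icc.2 hp.1))⟩
  symm
  refine Finset.prod_bij
    (fun p hp => Finset.Icc (⟨p.1, (hpair p hp).1⟩ : Fin N) ⟨p.2, (hpair p hp).2⟩) ?_ ?_ ?_ ?_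
  · rintro ⟨a, b⟩ hp
    obtain ⟨ha, hb⟩ := hpair _ hp
    rw [mem_natRuns] at hp
    obtain ⟨hab, hS, h1, h2⟩ := hp
    rw [mem_runsOf, isSuccessRun_Icc_iff (by simpa using hab)]
    refine ⟨fun x hx => ?_, fun i hi hiS => ?_, fun i hi hiS => ?_⟩
    · rw [Finset.mem_Icc, Fin.le_def, Fin.le_def] at hx
      exact (hmem x x.2).1 (hS (Finset.mem_Icc.2 hx))
    · exact h1 i hi ((hmem i i.2).2 hiS)
    · apply h2
      simp only at hi
      rw [hi]
      exact (hmem i i.2).2 hiS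
  · rintro ⟨a, b⟩ hp ⟨a', b'⟩ hp' h
    have hab := (mem_natRuns.1 hp).1
    have hab' := (mem_natRuns.1 hp').1
    simp only at h
    have h1 := Finset.mem_Icc.1 (h ▸ Finset.left_mem_Icc.2 (Fin.mk_le_mk.2 hab))
    have h2 := Finset.mem_Icc.1 (h ▸ Finset.right_mem_Icc.2 (Fin.mk_le_mk.2 hab))
    have h3 := Finset.mem_Icc.1 (h.symm ▸ Finset.left_mem_Icc.2 (Fin.mk_le_mk.2 hab'))
    have h4 := Finset.mem_Icc.1 (h.symm ▸ Finset.right_mem_Icc.2 (Fin.mk_le_mk.2 hab'))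
    simp only [Fin.mk_le_mk] at h1 h2 h3 h4
    rw [Prod.mk.injEq]
    omega
  · intro B hB
    obtain ⟨a, b, hab, rfl, hS, ha, hb⟩ := mem_runsOf.1 hB
    refine ⟨(a, b), ?_, rfl⟩
    rw [mem_natRuns]
    refine ⟨hab, fun n hn => ?_, fun i hi hiS => ?_, fun hbS => ?_⟩
    · rw [Finset.mem_Icc] at hn
      have hnN : n < N := hn.2.trans_lt b.2
      exact (hmem n hnN).2 (hS (Finset.mem_Icc.2 ⟨hn.1, hn.2⟩))
    · exact ha ⟨i, hlt _ hiS⟩ hi ((hmem i _).1 hiS)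
    · exact hb ⟨b + 1, hlt _ hbS⟩ rfl ((hmem _ _).1 hbS)
  · rintro ⟨a, b⟩ hp
    simp

lemma sum_prod_runsOf_eq_runSum (F : ℕ → ℝ) (N : ℕ) :
    ∑ S : Finset (Fin N), ∏ B ∈ runsOf S, F B.card = runSum F N := by
  rw [runSum]
  refine Finset.sum_bij (fun S _ => S.map Fin.valEmbedding) ?_ ?_ ?_ ?_
  · intro S _
    rw [Finset.mem_powerset]
    intro n hn
    obtain ⟨i, _, rfl⟩ := Finset.mem_map.1 hn
    exact Finset.mem_range.2 i.2
  · intro S _ S' _ h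
    exact Finset.map_injective _ h
  · intro T hT
    rw [Finset.mem_powerset] at hT
    refine ⟨Finset.univ.filter fun i : Fin N => (i : ℕ) ∈ T, Finset.mem_univ _, ?_⟩
    ext n
    simp only [Finset.mem_map, Finset.mem_filter, Finset.mem_univ, true_and,
      Fin.valEmbedding_apply]
    constructor
    · rintro ⟨i, hi, rfl⟩
      exact hi
    · exact fun hn => ⟨⟨n, Finset.mem_range.1 (hT hn)⟩, hn, rfl⟩
  · exact fun S _ => prod_runsOf_eq_runProd F S

/-! ### Independence of disjoint blocks of observations -/

section Independence

variable {Ω : Type*} {N : ℕ} {X : Fin N → Ω → ℝ}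

/-- The σ-algebra generated by the observations with index in `B`. -/
@[reducible] def blockSigma (X : Fin N → Ω → ℝ) (B : Finset (Fin N)) : MeasurableSpace Ω :=
  ⨆ i ∈ (B : Set (Fin N)), MeasurableSpace.comap (X i) inferInstance

lemma blockSigma_mono {B C : Finset (Fin N)} (h : B ⊆ C) : blockSigma X B ≤ blockSigma X C :=
  biSup_mono fun _ hi => h hi

lemma measurable_blockSigma {B : Finset (Fin N)} {i : Fin N} (hi : i ∈ B) :
    Measurable[blockSigma X B] (X i) :=
  (comap_measurable (X i)).mono
    (le_biSup (fun i => MeasurableSpace.comap (X i) inferInstance) (Finset.mem_coe.2 hi)) le_rfl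

/-- The event that all observations with index in `B` are successes. -/
def allSuccess (X : Fin N → Ω → ℝ) (m : Fin N → ℝ) (B : Finset (Fin N)) : Set Ω :=
  {ω | ∀ i ∈ B, m i < X i ω}

/-- The event that all observations with index in `C` are failures. -/
def allFailure (X : Fin N → Ω → ℝ) (m : Fin N → ℝ) (C : Finset (Fin N)) : Set Ω :=
  {ω | ∀ i ∈ C, ¬ m i < X i ω}

lemma measurableSet_allSuccess (m : Fin N → ℝ) (B : Finset (Fin N)) :
    MeasurableSet[blockSigma X B] (allSuccess X m B) := by
  have : allSuccess X m B = ⋂ i ∈ B, X i ⁻¹' Set.Ioi (m i) := by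
    ext ω; simp [allSuccess]
  rw [this]
  exact Finset.measurableSet_biInter _ fun i hi => measurable_blockSigma hi measurableSet_Ioi

lemma measurableSet_allFailure (m : Fin N → ℝ) (C : Finset (Fin N)) :
    MeasurableSet[blockSigma X C] (allFailure X m C) := by
  have : allFailure X m C = ⋂ i ∈ C, X i ⁻¹' Set.Iic (m i) := by
    ext ω; simp [allFailure]
  rw [this]
  exact Finset.measurableSet_biInter _ fun i hi => measurable_blockSigma hi measurableSet_Iic

lemma measurableSet_runWeight_lt {w : Weight N} (hw : ∀ B, Measurable (w B)) (t : ℝ)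
    (B : Finset (Fin N)) :
    MeasurableSet[blockSigma X B] {ω | runWeight w (fun i => X i ω) B < t} := by
  have h : Measurable[blockSigma X B] fun ω => w B (fun i : B => X i ω) :=
    (hw B).comp (@measurable_pi_lambda _ _ _ (blockSigma X B) _ _
      fun i => measurable_blockSigma i.2)
  exact h measurableSet_Iio

/-- The pattern `S` occurs when the indices outside `S` fail and every run of `S` succeeds; each
factor concerns its own block of observations. -/
lemma setOf_successSet_eq (m : Fin N → ℝ) (S : Finset (Fin N)) :
    {ω | successSet m (fun i => X i ω) = S} =
      allFailure X m Sᶜ ∩ ⋂ B ∈ runsOf S, allSuccess X m B := by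
  ext ω
  simp only [Set.mem_ofPred_eq, Set.mem_inter_iff, Set.mem_iInter, allFailure, allSuccess,
    mem_runsOf, Finset.mem_compl]
  constructor
  · rintro rfl
    simp only [successSet, Finset.mem_filter, Finset.mem_univ, true_and]
    exact ⟨fun _ h => h, fun B hB i hi => by simpa [successSet] using hB.subset hi⟩
  · rintro ⟨h1, h2⟩
    ext i
    simp only [successSet, Finset.mem_filter, Finset.mem_univ, true_and]
    constructor
    · intro h
      by_contra hi
      exact h1 i hi h
    · intro hi
      obtain ⟨B, hB, hiB⟩ := exists_isSuccessRun_mem hi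
      exact h2 B hB i hiB

variable [MeasurableSpace Ω] {P : Measure Ω}

lemma blockSigma_le (hX : ∀ i, Measurable (X i)) (B : Finset (Fin N)) :
    blockSigma X B ≤ (inferInstance : MeasurableSpace Ω) :=
  iSup₂_le fun i _ => (hX i).comap_le

lemma measurableSet_successSet_eq (hX : ∀ i, Measurable (X i)) (m : Fin N → ℝ)
    (S : Finset (Fin N)) : MeasurableSet {ω | successSet m (fun i => X i ω) = S} := by
  rw [setOf_successSet_eq]
  exact (blockSigma_le hX _ _ (measurableSet_allFailure m _)).inter
    (Finset.measurableSet_biInter _ fun B _ =>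
      blockSigma_le hX _ _ (measurableSet_allSuccess m B))

/-- All success patterns are equally likely. -/
lemma measureReal_successSet_eq [IsProbabilityMeasure P] (hX : ∀ i, Measurable (X i))
    (hindep : iIndepFun X P) {m : Fin N → ℝ} (hhalf : ∀ i, P.real {ω | m i < X i ω} = 1 / 2)
    (S : Finset (Fin N)) :
    P.real {ω | successSet m (fun i => X i ω) = S} = (1 / 2) ^ N := by
  have hset : {ω | successSet m (fun i => X i ω) = S} =
      ⋂ i ∈ Finset.univ, X i ⁻¹' (if i ∈ S then Set.Ioi (m i) else Set.Iic (m i)) := by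
    ext ω
    simp only [Set.mem_ofPred_eq, Finset.mem_univ, Set.iInter_true, Set.mem_iInter,
      Set.mem_preimage, successSet, Finset.ext_iff, Finset.mem_filter, true_and]
    refine forall_congr' fun i => ?_
    by_cases hi : i ∈ S <;> simp [hi]
  rw [hset, measureReal_def, hindep.measure_inter_preimage_eq_mul Finset.univ
    (sets := fun i => if i ∈ S then Set.Ioi (m i) else Set.Iic (m i)), ENNReal.toReal_prod]
  · have hone : ∀ i, (P (X i ⁻¹' (if i ∈ S then Set.Ioi (m i) else Set.Iic (m i)))).toReal =
        1 / 2 := by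
      intro i
      rw [← measureReal_def]
      have h1 : P.real (X i ⁻¹' Set.Ioi (m i)) = 1 / 2 := hhalf i
      split_ifs
      · exact h1
      · rw [← Set.compl_Ioi, Set.preimage_compl,
          probReal_compl_eq_one_sub (hX i measurableSet_Ioi), h1]
        norm_num
    rw [Finset.prod_congr rfl fun i _ => hone i]
    simp
  · intro i _
    split_ifs
    exacts [measurableSet_Ioi, measurableSet_Iic]

lemma measureReal_inter_of_disjoint (hX : ∀ i, Measurable (X i)) (hindep : iIndepFun X P)
    {B C : Finset (Fin N)} (hBC : Disjoint B C) {s t : Set Ω}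
    (hs : MeasurableSet[blockSigma X B] s) (ht : MeasurableSet[blockSigma X C] t) :
    P.real (s ∩ t) = P.real s * P.real t := by
  have h := indep_iSup_of_disjoint (fun i => (hX i).comap_le)
    ((iIndepFun_iff_iIndep _ _ _).1 hindep) (Finset.disjoint_coe.2 hBC)
  simp only [measureReal_def, (Indep_iff _ _ _).1 h s t hs ht, ENNReal.toReal_mul]

/-- Events `A B` depending on disjoint blocks, and a further event `D` depending on indices outside
these blocks, are independent. -/
lemma measureReal_inter_biInter_of_disjoint (hX : ∀ i, Measurable (X i))
    (hindep : iIndepFun X P) {A : Finset (Fin N) → Set Ω}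
    (hA : ∀ B, MeasurableSet[blockSigma X B] (A B)) (𝓑 : Finset (Finset (Fin N)))
    (h𝓑 : (𝓑 : Set (Finset (Fin N))).PairwiseDisjoint id) {C : Finset (Fin N)}
    (hC : ∀ B ∈ 𝓑, Disjoint C B) {D : Set Ω} (hD : MeasurableSet[blockSigma X C] D) :
    P.real (D ∩ ⋂ B ∈ 𝓑, A B) = P.real D * ∏ B ∈ 𝓑, P.real (A B) := by
  induction 𝓑 using Finset.induction_on generalizing C D with
  | empty => simp
  | insert B 𝓑 hB ih =>
    rw [Finset.coe_insert] at h𝓑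
    have hstep := ih (h𝓑.subset (Set.subset_insert _ _)) (C := C ∪ B) (D := D ∩ A B) ?_ ?_
    · rw [Finset.set_biInter_insert, ← Set.inter_assoc, hstep, Finset.prod_insert hB,
        measureReal_inter_of_disjoint hX hindep (hC B (Finset.mem_insert_self _ _)) hD (hA B),
        mul_assoc]
    · intro B' hB'
      rw [Finset.disjoint_union_left]
      refine ⟨hC B' (Finset.mem_insert_of_mem hB'), ?_⟩
      exact h𝓑 (Set.mem_insert _ _) (Set.mem_insert_of_mem _ hB') (by rintro rfl; exact hB hB')
    · exact (blockSigma_mono Finset.subset_union_left _ hD).inter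
        (blockSigma_mono Finset.subset_union_right _ (hA B))

/-- Conditioning on `B` being a success run amounts to conditioning on all its observations being
successes, as the failures next to `B` are independent of the observations in `B`. -/
lemma probRunWeightLT_mul_allSuccess [IsProbabilityMeasure P] (hX : ∀ i, Measurable (X i))
    (hindep : iIndepFun X P) {m : Fin N → ℝ} (hhalf : ∀ i, P.real {ω | m i < X i ω} = 1 / 2)
    {w : Weight N} (hw : ∀ B, Measurable (w B)) (t : ℝ) {a b : Fin N} (hab : a ≤ b) :
    probRunWeightLT P X m w t (Finset.Icc a b) * P.real (allSuccess X m (Finset.Icc a b)) =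
      P.real (allSuccess X m (Finset.Icc a b) ∩
        {ω | runWeight w (fun i => X i ω) (Finset.Icc a b) < t}) := by
  classical
  set B := Finset.Icc a b with hBdef
  -- the neighbours of the block
  set C : Finset (Fin N) :=
    Finset.univ.filter fun i => (i : ℕ) + 1 = a ∨ (b : ℕ) + 1 = i with hC
  have hBC : Disjoint B C := by
    rw [Finset.disjoint_left]
    intro i hi hi'
    rw [hBdef, Finset.mem_Icc, Fin.le_def, Fin.le_def] at hi
    have := (Finset.mem_filter.1 hi').2
    omega
  have hrun : {ω | B ∈ successRuns m (fun i => X i ω)} = allSuccess X m B ∩ allFailure X m C := by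
    ext ω
    rw [Set.mem_ofPred_eq, successRuns_eq_runsOf, mem_runsOf, isSuccessRun_Icc_iff hab,
      Set.mem_inter_iff]
    simp only [allSuccess, allFailure, Set.mem_ofPred_eq, hC, Finset.mem_filter, Finset.mem_univ,
      true_and, Finset.subset_iff, successSet]
    refine and_congr Iff.rfl ⟨fun h i hi => ?_, fun h => ⟨fun i hi => h i (Or.inl hi),
      fun i hi => h i (Or.inr hi)⟩⟩
    exact hi.elim (h.1 i) (h.2 i)
  have hmS := measurableSet_allSuccess (X := X) m B
  have hmF := measurableSet_allFailure (X := X) m C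
  have hmW := measurableSet_runWeight_lt (X := X) hw t B
  have hmrun : MeasurableSet (allSuccess X m B ∩ allFailure X m C) :=
    (blockSigma_le hX _ _ hmS).inter (blockSigma_le hX _ _ hmF)
  -- the pattern with `B` as its set of successes has positive probability
  have hpos : 0 < P.real (allSuccess X m B ∩ allFailure X m C) := by
    have hle : P.real {ω | successSet m (fun i => X i ω) = B} ≤
        P.real (allSuccess X m B ∩ allFailure X m C) := by
      refine measureReal_mono fun ω hω => ?_
      have hω' : successSet m (fun i => X i ω) = B := hω
      rw [Finset.ext_iff] at hω'
      simp only [successSet, Finset.mem_filter, Finset.mem_univ, true_and] at hω'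
      exact ⟨fun i hi => (hω' i).2 hi,
        fun i hi h => Finset.disjoint_left.1 hBC ((hω' i).1 h) hi⟩
    rw [measureReal_successSet_eq hX hindep hhalf] at hle
    exact lt_of_lt_of_le (by positivity) hle
  have h1 := measureReal_inter_of_disjoint hX hindep hBC hmS hmF
  have h2 := measureReal_inter_of_disjoint hX hindep hBC (hmS.inter hmW) hmF
  rw [h1] at hpos
  have hF : P.real (allFailure X m C) ≠ 0 := fun h => by simp [h] at hpos
  have hS : P.real (allSuccess X m B) ≠ 0 := fun h => by simp [h] at hpos
  rw [probRunWeightLT, hrun, measureReal_def, cond_apply hmrun, ENNReal.toReal_mul,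
    ENNReal.toReal_inv, ← measureReal_def, ← measureReal_def, Set.inter_right_comm, h1, h2]
  field_simp

/-! ### The law of the runs statistic -/

lemma runsStatistic_lt_iff {w : Weight N} {m x : Fin N → ℝ} {S : Finset (Fin N)}
    (hS : S.Nonempty) (hx : successSet m x = S) (t : ℝ) :
    runsStatistic w m x < t ↔ ∀ B ∈ runsOf S, runWeight w x B < t := by
  have hruns : successRuns m x = runsOf S := by rw [successRuns_eq_runsOf, hx]
  have hne : (successRuns m x).Nonempty := by
    obtain ⟨i, hi⟩ := hS
    obtain ⟨B, hB, _⟩ := exists_isSuccessRun_mem hi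
    exact ⟨B, hruns ▸ mem_runsOf.2 hB⟩
  rw [runsStatistic, dif_pos hne, Finset.sup'_lt_iff, hruns]

/-- On each success pattern the weights of the runs are independent. -/
lemma measureReal_successSet_inter_weights [IsProbabilityMeasure P]
    (hX : ∀ i, Measurable (X i)) (hindep : iIndepFun X P) {m : Fin N → ℝ}
    (hhalf : ∀ i, P.real {ω | m i < X i ω} = 1 / 2)
    {w : Weight N} (hw : ∀ B, Measurable (w B)) (t : ℝ) {F : ℕ → ℝ}
    (hF : ∀ a b : Fin N, a ≤ b →
      probRunWeightLT P X m w t (Finset.Icc a b) = F (Finset.Icc a b).card)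
    (S : Finset (Fin N)) :
    P.real ({ω | successSet m (fun i => X i ω) = S} ∩
        ⋂ B ∈ runsOf S, {ω | runWeight w (fun i => X i ω) B < t}) =
      (∏ B ∈ runsOf S, F B.card) * (1 / 2) ^ N := by
  have hdisj : (runsOf S : Set (Finset (Fin N))).PairwiseDisjoint id := by
    intro B hB B' hB' hne
    rw [Function.onFun, id, id, Finset.disjoint_left]
    exact fun i hi hi' => hne ((mem_runsOf.1 hB).eq_of_mem (mem_runsOf.1 hB') hi hi')
  have hcompl : ∀ B ∈ runsOf S, Disjoint Sᶜ B := by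
    intro B hB
    rw [Finset.disjoint_left]
    exact fun i hi hi' => Finset.mem_compl.1 hi ((mem_runsOf.1 hB).subset hi')
  have hinter : (⋂ B ∈ runsOf S, allSuccess X m B) ∩
      ⋂ B ∈ runsOf S, {ω | runWeight w (fun i => X i ω) B < t} =
      ⋂ B ∈ runsOf S, allSuccess X m B ∩ {ω | runWeight w (fun i => X i ω) B < t} := by
    simp only [Set.iInter_inter_distrib]
  rw [← measureReal_successSet_eq hX hindep hhalf S, setOf_successSet_eq, Set.inter_assoc, hinter,
    measureReal_inter_biInter_of_disjoint hX hindep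
      (fun B => (measurableSet_allSuccess m B).inter (measurableSet_runWeight_lt hw t B))
      _ hdisj hcompl (measurableSet_allFailure m _),
    measureReal_inter_biInter_of_disjoint hX hindep
      (fun B => measurableSet_allSuccess m B) _ hdisj hcompl (measurableSet_allFailure m _),
    mul_left_comm, ← Finset.prod_mul_distrib]
  refine congrArg _ (Finset.prod_congr rfl fun B hB => ?_)
  obtain ⟨a, b, hab, rfl, -⟩ := mem_runsOf.1 hB
  rw [← hF a b hab, probRunWeightLT_mul_allSuccess hX hindep hhalf hw t hab]

/-- The partition formula for observations with success probability `1 / 2`: the sum of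
`(∏ F |B|) / 2 ^ N` over the nonempty patterns, divided by `1 - 1 / 2 ^ N`. -/
theorem probRunsStatisticLT_eq_partitionSum [IsProbabilityMeasure P] (hN : 1 ≤ N)
    (hX : ∀ i, Measurable (X i)) (hindep : iIndepFun X P) {m : Fin N → ℝ}
    (hhalf : ∀ i, P.real {ω | m i < X i ω} = 1 / 2)
    {w : Weight N} (hw : ∀ B, Measurable (w B)) (t : ℝ) {F : ℕ → ℝ}
    (hF : ∀ a b : Fin N, a ≤ b →
      probRunWeightLT P X m w t (Finset.Icc a b) = F (Finset.Icc a b).card) :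
    probRunsStatisticLT P X m w t = partitionSum N F := by
  have hE : {ω | ∃ i, m i < X i ω} = {ω | successSet m (fun i => X i ω) = ∅}ᶜ := by
    ext ω
    simp [successSet, Finset.filter_eq_empty_iff]
  have hmE : MeasurableSet {ω | ∃ i, m i < X i ω} := by
    rw [hE]
    exact (measurableSet_successSet_eq hX m ∅).compl
  have hPE : P.real {ω | ∃ i, m i < X i ω} = 1 - (1 / 2) ^ N := by
    rw [hE, probReal_compl_eq_one_sub (measurableSet_successSet_eq hX m ∅),
      measureReal_successSet_eq hX hindep hhalf]
  have hdecomp : {ω | ∃ i, m i < X i ω} ∩ {ω | runsStatistic w m (fun i => X i ω) < t} =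
      ⋃ S ∈ (Finset.univ.erase ∅ : Finset (Finset (Fin N))),
        ({ω | successSet m (fun i => X i ω) = S} ∩
          ⋂ B ∈ runsOf S, {ω | runWeight w (fun i => X i ω) B < t}) := by
    rw [hE]
    ext ω
    simp only [Set.mem_inter_iff, Set.mem_compl_iff, Set.mem_ofPred_eq, Set.mem_iUnion,
      Finset.mem_erase, Finset.mem_univ, and_true, Set.mem_iInter]
    constructor
    · rintro ⟨hne, hlt⟩
      exact ⟨_, hne, rfl, (runsStatistic_lt_iff (Finset.nonempty_iff_ne_empty.2 hne) rfl t).1 hlt⟩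
    · rintro ⟨S, hne, hS, hlt⟩
      exact ⟨hS ▸ hne, (runsStatistic_lt_iff (Finset.nonempty_iff_ne_empty.2 hne) hS t).2 hlt⟩
  have hsum : P.real ({ω | ∃ i, m i < X i ω} ∩
      {ω | runsStatistic w m (fun i => X i ω) < t}) = (runSum F N - 1) * (1 / 2) ^ N := by
    rw [hdecomp, measureReal_biUnion_finset]
    · rw [Finset.sum_congr rfl fun S _ =>
        measureReal_successSet_inter_weights hX hindep hhalf hw t hF S, ← Finset.sum_mul,
        ← sum_prod_runsOf_eq_runSum, ← Finset.add_sum_erase _ _ (Finset.mem_univ ∅)]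
      have hempty : runsOf (∅ : Finset (Fin N)) = ∅ := by
        refine Finset.eq_empty_of_forall_notMem fun B hB => ?_
        obtain ⟨a, b, hab, rfl, h, -⟩ := mem_runsOf.1 hB
        exact absurd (h (Finset.left_mem_Icc.2 hab)) (Finset.notMem_empty _)
      simp [hempty]
    · intro S _ S' _ hne
      rw [Function.onFun, Set.disjoint_left]
      rintro ω ⟨h, -⟩ ⟨h', -⟩
      exact hne (Eq.trans (Eq.symm h) h')
    · intro S _
      exact (measurableSet_successSet_eq hX m S).inter (Finset.measurableSet_biInter _
        fun B _ => blockSigma_le hX _ _ (measurableSet_runWeight_lt hw t B))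
  rw [probRunsStatisticLT, measureReal_def, cond_apply hmE, ENNReal.toReal_mul,
    ENNReal.toReal_inv, ← measureReal_def, ← measureReal_def, hPE, hsum,
    partitionSum_eq_runSum]
  have h2 : (1 : ℝ) < 2 ^ N := one_lt_pow₀ (by norm_num) (by omega)
  have h3 : (1 / 2 : ℝ) ^ N = (2 ^ N)⁻¹ := by rw [one_div, inv_pow]
  rw [h3]
  have h4 : (2 : ℝ) ^ N - 1 ≠ 0 := by linarith
  field_simp

end Independence

/-! ### The moment generating function of the gamma distribution -/

/-- Finite measures with the same moment generating function, finite near `0`, agree. -/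
lemma measure_ext_of_mgf_eq {μ ν : Measure ℝ} [IsProbabilityMeasure μ] [IsProbabilityMeasure ν]
    (h : mgf id μ = mgf id ν) (h0 : 0 ∈ interior (integrableExpSet id μ)) : μ = ν := by
  refine Measure.ext_of_charFun (funext fun s => ?_)
  have := eqOn_complexMGF_of_mgf h (x := s * Complex.I) (by simpa using h0)
  rwa [complexMGF_id_mul_I, complexMGF_id_mul_I] at this

lemma integral_gammaMeasure {a r : ℝ} (ha : 0 < a) (hr : 0 < r) (f : ℝ → ℝ) :
    ∫ x, f x ∂(gammaMeasure a r) =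
      ∫ x in Set.Ioi 0, r ^ a / Real.Gamma a * x ^ (a - 1) * Real.exp (-(r * x)) * f x := by
  have hm : Measurable (gammaPDF a r) := (measurable_gammaPDFReal a r).ennreal_ofReal
  rw [gammaMeasure, integral_withDensity_eq_integral_toReal_smul hm
    (Filter.Eventually.of_forall fun x => ENNReal.ofReal_lt_top), ← integral_Ici_eq_integral_Ioi,
    ← integral_indicator measurableSet_Ici]
  refine integral_congr_ae (Filter.Eventually.of_forall fun x => ?_)
  simp only [gammaPDF, ENNReal.toReal_ofReal (gammaPDFReal_nonneg ha hr x)]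
  simp only [smul_eq_mul, Set.indicator_apply, Set.mem_Ici, gammaPDFReal, ite_mul, zero_mul]

/-- For `t ≥ r` the moment generating function is infinite, and has the value `0` by convention. -/
lemma mgf_gammaMeasure {a r : ℝ} (ha : 0 < a) (hr : 0 < r) (t : ℝ) :
    mgf id (gammaMeasure a r) t = if t < r then (r / (r - t)) ^ a else 0 := by
  have hcongr : mgf id (gammaMeasure a r) t = r ^ a / Real.Gamma a *
      ∫ x in Set.Ioi (0 : ℝ), x ^ (a - 1) * Real.exp (-((r - t) * x)) := by
    rw [mgf, integral_gammaMeasure ha hr, ← integral_const_mul]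
    refine integral_congr_ae (Filter.Eventually.of_forall fun x => ?_)
    simp only [id]
    rw [show -((r - t) * x) = -(r * x) + t * x by ring, Real.exp_add]
    ring
  rw [hcongr]
  split_ifs with ht
  · have hrt : 0 < r - t := by linarith
    rw [Real.integral_rpow_mul_exp_neg_mul_Ioi ha hrt, Real.div_rpow hr.le hrt.le,
      Real.div_rpow zero_le_one hrt.le, Real.one_rpow]
    have := (Real.Gamma_pos_of_pos ha).ne'
    field_simp
  · rw [integral_undef, mul_zero]
    -- for `t ≥ r` the integrand dominates a power, which is not integrable
    intro hint
    refine not_integrableOn_Ioi_rpow (a - 1) (Integrable.mono' hint (by fun_prop) ?_)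
    refine (ae_restrict_iff' measurableSet_Ioi).2 (Filter.Eventually.of_forall fun x hx => ?_)
    have hx' : (0 : ℝ) < x := hx
    have h1 : 0 ≤ x ^ (a - 1) := Real.rpow_nonneg hx'.le _
    rw [Real.norm_of_nonneg h1]
    refine le_mul_of_one_le_right h1 (Real.one_le_exp ?_)
    nlinarith

lemma zero_mem_interior_integrableExpSet_gammaMeasure {a r : ℝ} (ha : 0 < a) (hr : 0 < r) :
    0 ∈ interior (integrableExpSet id (gammaMeasure a r)) := by
  have := isProbabilityMeasure_gammaMeasure ha hr
  refine mem_interior.2 ⟨Set.Iio r, fun t ht => ?_, isOpen_Iio, hr⟩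
  have ht' : t < r := ht
  rw [integrableExpSet, Set.mem_ofPred_eq, ← mgf_pos_iff, mgf_gammaMeasure ha hr, if_pos ht']
  have : 0 < r - t := by linarith
  positivity

lemma measureReal_gammaMeasure_Iio {a r : ℝ} (ha : 0 < a) (hr : 0 < r) {t : ℝ} (ht : 0 ≤ t) :
    (gammaMeasure a r).real (Set.Iio t) =
      ∫ x in (0 : ℝ)..t, r ^ a / Real.Gamma a * x ^ (a - 1) * Real.exp (-(r * x)) := by
  have := isProbabilityMeasure_gammaMeasure ha hr
  rw [← integral_indicator_one measurableSet_Iio, integral_gammaMeasure ha hr,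
    intervalIntegral.integral_of_le ht, integral_Ioc_eq_integral_Ioo,
    ← Set.Ioi_inter_Iio, ← setIntegral_indicator measurableSet_Iio]
  refine integral_congr_ae (Filter.Eventually.of_forall fun x => ?_)
  simp [Set.indicator_apply]

/-! ### The weight of a run of Gaussian observations -/

/-- The partial moment generating function of the square of a standardized Gaussian variable, on
the event that it is positive. It is valid for all `s`: for `s ≥ 1 / 2` the integral
diverges, and both sides are `0` by convention. This makes the moment generating functions agree
everywhere, as needed for `measure_ext_of_mgf_eq`. -/
lemma setIntegral_exp_mul_sq_gaussianReal (μ : ℝ) {σ : ℝ} (hσ : 0 < σ) (s : ℝ) :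
    ∫ x in Set.Ioi μ, Real.exp (s * ((x - μ) ^ 2 / σ ^ 2))
      ∂(gaussianReal μ (Real.toNNReal (σ ^ 2))) =
        (√(2 * Real.pi))⁻¹ * (√(Real.pi / (1 / 2 - s)) / 2) := by
  have hv : Real.toNNReal (σ ^ 2) ≠ 0 := by simp [hσ.ne']
  have hmap : gaussianReal μ (Real.toNNReal (σ ^ 2)) =
      (gaussianReal 0 1).map fun z => σ * z + μ := by
    have h1 : (gaussianReal 0 1).map (fun z => σ * z + μ) =
        ((gaussianReal 0 1).map (σ * ·)).map (· + μ) := by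
      rw [Measure.map_map (by fun_prop) (by fun_prop)]
      rfl
    rw [h1, gaussianReal_map_const_mul, gaussianReal_map_add_const]
    congr 1
    · simp
    · ext
      simp [Real.coe_toNNReal _ (sq_nonneg σ)]
  rw [hmap, setIntegral_map measurableSet_Ioi (by fun_prop) (by fun_prop)]
  have hpre : (fun z => σ * z + μ) ⁻¹' Set.Ioi μ = Set.Ioi 0 := by
    ext z
    simp [hσ]
  rw [hpre, ← integral_indicator measurableSet_Ioi,
    integral_gaussianReal_eq_integral_smul one_ne_zero, ← integral_gaussian_Ioi,
    ← integral_const_mul, ← integral_indicator measurableSet_Ioi]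
  refine integral_congr_ae (Filter.Eventually.of_forall fun z => ?_)
  simp only [Set.indicator_apply]
  split_ifs
  · rw [gaussianPDFReal, smul_eq_mul]
    have h1 : (σ * z + μ - μ) ^ 2 / σ ^ 2 = z ^ 2 := by
      field_simp
      ring
    rw [h1, mul_assoc, ← Real.exp_add]
    simp only [NNReal.coe_one, mul_one, sub_zero]
    congr 2
    ring
  · simp

section Gaussian

variable {Ω : Type*} [MeasurableSpace Ω] {P : Measure Ω} {N : ℕ} {X : Fin N → Ω → ℝ}

lemma setIntegral_exp_mul_sq (hX : ∀ i, Measurable (X i)) {m σ : Fin N → ℝ}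
    (hσ : ∀ i, 0 < σ i)
    (hlaw : ∀ i, P.map (X i) = gaussianReal (m i) (Real.toNNReal (σ i ^ 2))) (s : ℝ)
    (i : Fin N) :
    ∫ ω in {ω | m i < X i ω}, Real.exp (s * ((X i ω - m i) ^ 2 / σ i ^ 2)) ∂P =
      (√(2 * Real.pi))⁻¹ * (√(Real.pi / (1 / 2 - s)) / 2) := by
  rw [← setIntegral_exp_mul_sq_gaussianReal (m i) (hσ i) s, ← hlaw i,
    setIntegral_map measurableSet_Ioi (by fun_prop) (hX i).aemeasurable]
  rfl

lemma measureReal_gaussian_success [IsProbabilityMeasure P] (hX : ∀ i, Measurable (X i))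
    {m σ : Fin N → ℝ} (hσ : ∀ i, 0 < σ i)
    (hlaw : ∀ i, P.map (X i) = gaussianReal (m i) (Real.toNNReal (σ i ^ 2))) (i : Fin N) :
    P.real {ω | m i < X i ω} = 1 / 2 := by
  have h := setIntegral_exp_mul_sq hX hσ hlaw 0 i
  simp only [zero_mul, Real.exp_zero, setIntegral_const, smul_eq_mul, mul_one, sub_zero] at h
  rw [h, show Real.pi / (1 / 2) = 2 * Real.pi by ring]
  have : √(2 * Real.pi) ≠ 0 := by positivity
  field_simp

/-- Given that all observations in a block are successes, the weight of the block follows the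
`χ²` distribution, a gamma distribution. -/
lemma map_chiSqWeight_cond [IsProbabilityMeasure P] (hX : ∀ i, Measurable (X i))
    (hindep : iIndepFun X P) {m σ : Fin N → ℝ} (hσ : ∀ i, 0 < σ i)
    (hlaw : ∀ i, P.map (X i) = gaussianReal (m i) (Real.toNNReal (σ i ^ 2)))
    {B : Finset (Fin N)} (hB : B.Nonempty) :
    (P[|allSuccess X m B]).map (fun ω => runWeight (chiSqWeight m σ) (fun i => X i ω) B) =
      gammaMeasure ((B.card : ℝ) / 2) (1 / 2) := by
  have hcard : 0 < (B.card : ℝ) / 2 := by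
    have := hB.card_pos
    positivity
  have hmS : MeasurableSet (allSuccess X m B) := blockSigma_le hX _ _ (measurableSet_allSuccess m B)
  have hW : ∀ ω, runWeight (chiSqWeight m σ) (fun i => X i ω) B =
      ∑ i : B, (X i ω - m i) ^ 2 / σ i ^ 2 := fun ω => rfl
  have hmW : Measurable fun ω => runWeight (chiSqWeight m σ) (fun i => X i ω) B := by
    simp only [hW]
    fun_prop
  -- independence factorizes the partial moment generating function
  have hint : ∀ s : ℝ, ∫ ω in allSuccess X m B,
      Real.exp (s * runWeight (chiSqWeight m σ) (fun i => X i ω) B) ∂P =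
      ((√(2 * Real.pi))⁻¹ * (√(Real.pi / (1 / 2 - s)) / 2)) ^ B.card := by
    intro s
    have hindepB : iIndepFun (fun i : B => X i) P := hindep.precomp Subtype.val_injective
    have hprod := hindepB.integral_fun_prod_comp
      (f := fun (i : B) x => (Set.Ioi (m i)).indicator
        (fun x => Real.exp (s * ((x - m i) ^ 2 / σ i ^ 2))) x)
      (fun i => (hX i).aemeasurable)
      (fun i => (Measurable.indicator (by fun_prop) measurableSet_Ioi).aestronglyMeasurable)
    have hfactor : ∀ i : B, ∫ ω, (Set.Ioi (m i)).indicator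
        (fun x => Real.exp (s * ((x - m i) ^ 2 / σ i ^ 2))) (X i ω) ∂P =
        (√(2 * Real.pi))⁻¹ * (√(Real.pi / (1 / 2 - s)) / 2) := by
      intro i
      rw [← setIntegral_exp_mul_sq hX hσ hlaw s i,
        ← integral_indicator (measurableSet_lt measurable_const (hX i))]
      rfl
    rw [Finset.prod_congr rfl fun i _ => hfactor i, Finset.prod_const, Finset.card_univ,
      Fintype.card_coe] at hprod
    rw [← hprod, ← integral_indicator hmS]
    refine integral_congr_ae (Filter.Eventually.of_forall fun ω => ?_)
    dsimp only
    by_cases hω : ω ∈ allSuccess X m B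
    · rw [Set.indicator_of_mem hω, hW, Finset.mul_sum, Real.exp_sum]
      exact Finset.prod_congr rfl fun i _ => by
        rw [Set.indicator_of_mem (Set.mem_Ioi.2 (hω i i.2))]
    · rw [Set.indicator_of_notMem hω]
      have hω' : ∃ i ∈ B, ¬ m i < X i ω := by simpa [allSuccess] using hω
      obtain ⟨i, hi, hlt⟩ := hω'
      exact (Finset.prod_eq_zero (Finset.mem_univ (⟨i, hi⟩ : B))
        (Set.indicator_of_notMem hlt _)).symm
  have hpi : √(2 * Real.pi) ≠ 0 := by positivity
  have hPS : P.real (allSuccess X m B) = (1 / 2) ^ B.card := by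
    have h := hint 0
    simp only [zero_mul, Real.exp_zero, setIntegral_const, smul_eq_mul, mul_one, sub_zero] at h
    rw [h, show Real.pi / (1 / 2) = 2 * Real.pi by ring]
    congr 1
    field_simp
  have hPS0 : P (allSuccess X m B) ≠ 0 := by
    intro h
    rw [measureReal_def, h] at hPS
    exact absurd hPS.symm (by simp)
  have := cond_isProbabilityMeasure hPS0
  have := Measure.isProbabilityMeasure_map (μ := P[|allSuccess X m B]) hmW.aemeasurable
  have := isProbabilityMeasure_gammaMeasure hcard (by norm_num : (0 : ℝ) < 1 / 2)
  refine (measure_ext_of_mgf_eq ?_ (zero_mem_interior_integrableExpSet_gammaMeasure hcard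
    (by norm_num))).symm
  ext s
  rw [mgf_gammaMeasure hcard (by norm_num), mgf_id_map hmW.aemeasurable, mgf,
    ProbabilityTheory.cond, integral_smul_measure, hint s, ENNReal.toReal_inv, ← measureReal_def, hPS, smul_eq_mul,
    ← inv_pow, ← mul_pow]
  have hfac : (1 / 2 : ℝ)⁻¹ * ((√(2 * Real.pi))⁻¹ * (√(Real.pi / (1 / 2 - s)) / 2)) =
      √(1 / 2 / (1 / 2 - s)) := by
    rw [show Real.pi / (1 / 2 - s) = (2 * Real.pi) * (1 / 2 / (1 / 2 - s)) by ring,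
      Real.sqrt_mul (by positivity) (1 / 2 / (1 / 2 - s))]
    generalize √(1 / 2 / (1 / 2 - s)) = d
    field_simp
  rw [hfac]
  split_ifs with hs
  · have : 0 ≤ 1 / 2 / (1 / 2 - s) := div_nonneg (by norm_num) (by linarith)
    rw [Real.sqrt_eq_rpow, ← Real.rpow_natCast, ← Real.rpow_mul this]
    congr 1
    ring
  · rw [Real.sqrt_eq_zero_of_nonpos (div_nonpos_of_nonneg_of_nonpos (by norm_num) (by linarith)),
      zero_pow hB.card_pos.ne']

/-- The distribution function of the `χ²` distribution in terms of the incomplete gamma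
function. -/
lemma integral_chiSq_eq_lowerGamma {a : ℝ} (t : ℝ) (ht : 0 ≤ t) :
    ∫ x in (0 : ℝ)..t, (1 / 2 : ℝ) ^ a / Real.Gamma a * x ^ (a - 1) * Real.exp (-(1 / 2 * x)) =
      lowerGamma a (t / 2) / Real.Gamma a := by
  have h := intervalIntegral.integral_comp_div (a := 0) (b := t)
    (fun u : ℝ => u ^ (a - 1) * Real.exp (-u)) (two_ne_zero (α := ℝ))
  rw [zero_div] at h
  have h2 : lowerGamma a (t / 2) =
      (2 : ℝ)⁻¹ * ∫ x in (0 : ℝ)..t, (x / 2) ^ (a - 1) * Real.exp (-(x / 2)) := by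
    rw [h, lowerGamma, smul_eq_mul]
    ring
  rw [h2, mul_div_right_comm, ← intervalIntegral.integral_const_mul]
  refine intervalIntegral.integral_congr fun x hx => ?_
  rw [Set.uIcc_of_le ht] at hx
  rw [Real.div_rpow hx.1 zero_le_two, Real.div_rpow zero_le_one zero_le_two, Real.one_rpow,
    Real.rpow_sub_one two_ne_zero, show -(1 / 2 * x) = -(x / 2) by ring]
  have : (2 : ℝ) ^ a ≠ 0 := by positivity
  field_simp

lemma measurable_chiSqWeight (m σ : Fin N → ℝ) (B : Finset (Fin N)) :
    Measurable (chiSqWeight m σ B) := by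
  unfold chiSqWeight
  fun_prop

/-- `map_chiSqWeight_cond` with the condition that the block consists of successes replaced by the
condition that it is a success run. -/
lemma probRunWeightLT_chiSqWeight [IsProbabilityMeasure P] (hX : ∀ i, Measurable (X i))
    (hindep : iIndepFun X P) {m σ : Fin N → ℝ} (hσ : ∀ i, 0 < σ i)
    (hlaw : ∀ i, P.map (X i) = gaussianReal (m i) (Real.toNNReal (σ i ^ 2)))
    {t : ℝ} (ht : 0 ≤ t) {a b : Fin N} (hab : a ≤ b) :
    probRunWeightLT P X m (chiSqWeight m σ) t (Finset.Icc a b) =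
      ∫ x in (0 : ℝ)..t, (1 / 2 : ℝ) ^ (((Finset.Icc a b).card : ℝ) / 2) /
        Real.Gamma (((Finset.Icc a b).card : ℝ) / 2) *
        x ^ (((Finset.Icc a b).card : ℝ) / 2 - 1) * Real.exp (-(1 / 2 * x)) := by
  have hB : (Finset.Icc a b).Nonempty := ⟨a, Finset.left_mem_Icc.2 hab⟩
  have hcard : 0 < ((Finset.Icc a b).card : ℝ) / 2 := by
    have := hB.card_pos
    positivity
  have hhalf := measureReal_gaussian_success hX hσ hlaw
  have hw := measurable_chiSqWeight m σ
  have hmul := probRunWeightLT_mul_allSuccess hX hindep hhalf hw t hab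
  have hmS : MeasurableSet (allSuccess X m (Finset.Icc a b)) :=
    blockSigma_le hX _ _ (measurableSet_allSuccess m _)
  have hmW : Measurable fun ω =>
      runWeight (chiSqWeight m σ) (fun i => X i ω) (Finset.Icc a b) :=
    (hw _).comp (measurable_pi_lambda _ fun i => hX i)
  rw [← measureReal_gammaMeasure_Iio hcard (by norm_num) ht,
    ← map_chiSqWeight_cond hX hindep hσ hlaw hB,
    map_measureReal_apply hmW measurableSet_Iio, measureReal_def, cond_apply hmS,
    ENNReal.toReal_mul, ENNReal.toReal_inv, ← measureReal_def, ← measureReal_def]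
  have hS : P.real (allSuccess X m (Finset.Icc a b)) ≠ 0 := by
    intro h
    have hle : P.real {ω | successSet m (fun i => X i ω) = Finset.Icc a b} ≤
        P.real (allSuccess X m (Finset.Icc a b)) := by
      refine measureReal_mono fun ω hω i hi => ?_
      have hω' : successSet m (fun i => X i ω) = Finset.Icc a b := hω
      rw [← hω'] at hi
      simpa [successSet] using hi
    rw [measureReal_successSet_eq hX hindep hhalf, h] at hle
    exact absurd hle (not_le.2 (by positivity))
  rw [eq_inv_mul_iff_mul_eq₀ hS, mul_comm]
  exact hmul

end Gaussian

end RunsStatistic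

theorem mainTheorem1 {Ω : Type*} [MeasurableSpace Ω] (P : Measure Ω) [IsProbabilityMeasure P]
    (N : ℕ) (hN : 1 ≤ N) (X : Fin N → Ω → ℝ) (hX : ∀ i, Measurable (X i))
    (hindep : iIndepFun X P) (m : Fin N → ℝ) :
    -- arbitrary observations with success probability `1 / 2` and arbitrary weights, where
    -- `F l` is the probability that a success run of length `l` has weight less than `t`
    ((∀ i, P.real {ω | m i < X i ω} = 1 / 2) →
      ∀ (w : RunsStatistic.Weight N), (∀ B, Measurable (w B)) →
      ∀ (t : ℝ) (F : ℕ → ℝ),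
        (∀ a b : Fin N, a ≤ b →
          RunsStatistic.probRunWeightLT P X m w t (Finset.Icc a b) =
            F (Finset.Icc a b).card) →
        RunsStatistic.probRunsStatisticLT P X m w t = RunsStatistic.partitionSum N F) ∧
    -- Gaussian observations with the `χ²` of the run as its weight
    (∀ (σ : Fin N → ℝ), (∀ i, 0 < σ i) →
      (∀ i, P.map (X i) = gaussianReal (m i) (Real.toNNReal (σ i ^ 2))) →
      ∀ t : ℝ, 0 ≤ t →
        (∀ (l : ℕ) (a b : Fin N), a ≤ b → (Finset.Icc a b).card = l →
          RunsStatistic.probRunWeightLT P X m (RunsStatistic.chiSqWeight m σ) t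
              (Finset.Icc a b) =
            (∫ x in (0 : ℝ)..t, 1 / ((2 : ℝ) ^ ((l : ℝ) / 2) * Real.Gamma ((l : ℝ) / 2)) *
              Real.exp (-x / 2) * x ^ (-1 + (l : ℝ) / 2)) ∧
          RunsStatistic.probRunWeightLT P X m (RunsStatistic.chiSqWeight m σ) t
              (Finset.Icc a b) =
            RunsStatistic.lowerGamma ((l : ℝ) / 2) (t / 2) / Real.Gamma ((l : ℝ) / 2)) ∧
        RunsStatistic.probRunsStatisticLT P X m (RunsStatistic.chiSqWeight m σ) t =
          RunsStatistic.partitionSum N (fun l =>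
            RunsStatistic.lowerGamma ((l : ℝ) / 2) (t / 2) / Real.Gamma ((l : ℝ) / 2))) := by
  refine ⟨fun hhalf w hw t F hF =>
    RunsStatistic.probRunsStatisticLT_eq_partitionSum hN hX hindep hhalf hw t hF,
    fun σ hσ hlaw t ht => ?_⟩
  have hgamma : ∀ a b : Fin N, a ≤ b →
      RunsStatistic.probRunWeightLT P X m (RunsStatistic.chiSqWeight m σ) t (Finset.Icc a b) =
        RunsStatistic.lowerGamma (((Finset.Icc a b).card : ℝ) / 2) (t / 2) /
          Real.Gamma (((Finset.Icc a b).card : ℝ) / 2) := fun a b hab => by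
    rw [RunsStatistic.probRunWeightLT_chiSqWeight hX hindep hσ hlaw ht hab,
      RunsStatistic.integral_chiSq_eq_lowerGamma t ht]
  refine ⟨?_, ?_⟩
  · rintro l a b hab rfl
    refine ⟨?_, hgamma a b hab⟩
    rw [RunsStatistic.probRunWeightLT_chiSqWeight hX hindep hσ hlaw ht hab]
    refine intervalIntegral.integral_congr fun x _ => ?_
    rw [Real.div_rpow zero_le_one zero_le_two, Real.one_rpow, div_div,
      show (((Finset.Icc a b).card : ℝ) / 2 - 1) = -1 + ((Finset.Icc a b).card : ℝ) / 2 by ring,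
      show -(1 / 2 * x) = -x / 2 by ring]
    ring
  · exact RunsStatistic.probRunsStatisticLT_eq_partitionSum hN hX hindep
      (RunsStatistic.measureReal_gaussian_success hX hσ hlaw)
      (RunsStatistic.measurable_chiSqWeight m σ) t hgamma
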